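/- Let $p$ be a prime, let $F$ be a non-archimedean local field of residue characteristic $p$ (of characteristic $0$ or $p$), and let $k$ be an algebraically closed field of characteristic $p$ (for instance $k=\bar{\mathbb F}_p$). Let $G_S=\mathrm{SL}_2(F)$ with its usual topology, and let $B_S\subset G_S$ be the subgroup of upper triangular matrices. A representation of $G_S$ or of $B_S$ on a $k$-vector space, of arbitrary dimension, is called smooth if every vector has an open stabilizer. Let $\eta\colon B_S\to k^\times$ be a smooth character, and let $\mathrm{Ind}_{B_S}^{G_S}(\eta)$ be the space of all functions $f\colon G_S\to k$ such that $f(bg)=\eta(b)f(g)$ for all $b\in B_S$, $g\in G_S$, and such that $f$ has an open stabilizer for the action $(g\cdot f)(g')=f(g'g)$ of $G_S$. Let $V_\eta=\{f\in \mathrm{Ind}_{B_S}^{G_S}(\eta) : f(1)=0\}$, which is the kernel of the $B_S$-intertwiner $\mathrm{Ind}_{B_S}^{G_S}(\eta)\to\eta$, $f\mapsto f(1)$, and hence a $B_S$-subrepresentation of $\mathrm{Ind}_{B_S}^{G_S}(\eta)|_{B_S}$. Then for every smooth $k$-representation $\pi$ of $G_S$ the restriction map $$\mathrm{Hom}_{G_S}\bigl(\mathrm{Ind}_{B_S}^{G_S}(\eta),\pi\bigr)\longrightarrow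 \mathrm{Hom}_{B_S}\bigl(V_\eta,\pi|_{B_S}\bigr),\qquad \varphi\mapsto \varphi|_{V_\eta},$$ is an isomorphism of $k$-vector spaces. -/

import Mathlib

open scoped ValuativeRel MatrixGroups

namespace SmoothRep

section General

variable {k G V W : Type*} [Field k] [Group G] [TopologicalSpace G]
  [AddCommMonoid V] [Module k V] [AddCommMonoid W] [Module k W]

/-- A vector is smooth if it is fixed by some open subgroup, that is, if its stabilizer is open.
In a locally profinite group every open subgroup contains a compact open subgroup, so this is the
same as being fixed by some compact open subgroup. -/
def IsSmoothVector (ρ : Representation k G V) (v : V) : Prop :=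
  ∃ U : OpenSubgroup G, ∀ g ∈ U, ρ g v = v

/-- A representation is smooth if all of its vectors are smooth. -/
def IsSmooth (ρ : Representation k G V) : Prop :=
  ∀ v : V, IsSmoothVector ρ v

/-- The subrepresentation of all smooth vectors of a representation. -/
def smoothPart [IsTopologicalGroup G] (ρ : Representation k G V) : Subrepresentation ρ where
  toSubmodule :=
    { carrier := {v | IsSmoothVector ρ v}
      add_mem' := by
        rintro v w ⟨U, hU⟩ ⟨U', hU'⟩
        refine ⟨U ⊓ U', fun g hg => ?_⟩
        rw [OpenSubgroup.mem_inf] at hg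
        rw [map_add, hU g hg.1, hU' g hg.2]
      zero_mem' := ⟨⊤, fun g _ => map_zero _⟩
      smul_mem' := by
        rintro c v ⟨U, hU⟩
        exact ⟨U, fun g hg => by rw [map_smul, hU g hg]⟩ }
  apply_mem_toSubmodule := by
    rintro g v ⟨U, hU⟩
    refine ⟨U.comap (MulAut.conj g⁻¹).toMonoidHom (by
      change Continuous fun x : G => g⁻¹ * x * g⁻¹⁻¹
      fun_prop), fun h hh => ?_⟩
    have h1 : ρ (g⁻¹ * h * g) v = v := hU _ (by simpa using hh)
    have h2 : h * g = g * (g⁻¹ * h * g) := by group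
    rw [← Module.End.mul_apply, ← map_mul, h2, map_mul, Module.End.mul_apply, h1]

/-- The restriction of a representation of `G` to a subgroup `H`. -/
abbrev restrict (H : Subgroup G) (ρ : Representation k G V) : Representation k H V :=
  ρ.comp H.subtype

/-- The one-dimensional representation on `k` attached to a character `η : G → kˣ`. -/
def charRep (η : G →* kˣ) : Representation k G k where
  toFun g := (η g : k) • LinearMap.id
  map_one' := by ext; simp
  map_mul' g h := by ext; simp [mul_comm]

variable [IsTopologicalGroup G] (H : Subgroup G)

/-- The smooth induction from `H` to `G`: the smooth part of the space of all functions
`f : G → W` with `f (h * g) = σ h (f g)`, on which `G` acts by `(g • f) g' = f (g' * g)`. -/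
def smoothInd (σ : Representation k H W) :
    Subrepresentation (Representation.coind H.subtype σ) :=
  smoothPart (Representation.coind H.subtype σ)

/-- The representation of `G` on the smooth induction. -/
abbrev smoothIndRep (σ : Representation k H W) :
    Representation k G (smoothInd H σ).toSubmodule :=
  (smoothInd H σ).toRepresentation

/-- Evaluation at the identity element, as an `H`-intertwiner from the smooth induction of `σ`
to `σ`. -/
def evalOne (σ : Representation k H W) :
    (restrict H (smoothIndRep H σ)).IntertwiningMap σ where
  toFun f := (f : Representation.coindV H.subtype σ).1 1
  map_add' _ _ := rfl
  map_smul' _ _ := rfl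
  isIntertwining' h := by
    ext f
    have e := f.1.2 h 1
    change f.1.1 (1 * (h : G)) = σ h (f.1.1 1)
    simpa using e

/-- The `H`-subrepresentation of the smooth induction of `σ` on the functions that vanish at the
identity element. -/
def evalKer (σ : Representation k H W) : Subrepresentation (restrict H (smoothIndRep H σ)) :=
  (evalOne H σ).ker

/-- Restriction of a `G`-intertwiner `φ : Ind σ → π` to the `H`-intertwiner `φ|_{evalKer}`
from the kernel of evaluation at the identity to `π|_H`. -/
def restrictToEvalKer (σ : Representation k H W) (π : Representation k G V) :
    (smoothIndRep H σ).IntertwiningMap π →ₗ[k]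
      (evalKer H σ).toRepresentation.IntertwiningMap (restrict H π) where
  toFun φ :=
    { toLinearMap := φ.toLinearMap.comp (evalKer H σ).toSubmodule.subtype
      isIntertwining' := by
        intro h
        ext f
        exact Representation.IntertwiningMap.isIntertwining _ _ φ (h : G) f.1 }
  map_add' _ _ := rfl
  map_smul' _ _ := rfl

end General

/-- The Borel subgroup of upper triangular matrices in `SL₂(F)`. -/
def borelSL2 (F : Type*) [Field F] : Subgroup SL(2, F) where
  carrier := {g | g.1 1 0 = 0}
  one_mem' := by simp
  mul_mem' := by
    intro a b ha hb
    simp only [Set.mem_ofPred_eq] at ha hb ⊢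
    rw [Matrix.SpecialLinearGroup.coe_mul, Matrix.mul_apply, Fin.sum_univ_two, ha, hb]
    simp
  inv_mem' := by
    intro a ha
    simp only [Set.mem_ofPred_eq] at ha ⊢
    rw [Matrix.SpecialLinearGroup.coe_inv, Matrix.adjugate_fin_two]
    simp [ha]

end SmoothRep

/-!
Write `B` for the Borel subgroup, `w` for `weyl`, `u x` and `l y` for the upper and lower unipotent
matrices, `t s` for `torus s` and `Ind` for the smooth induction of `η`. Let `e ∈ Ind` be the
function supported on `B w u(𝒪)` with `e (w u(x)) = 1` for `x ∈ 𝒪` (`bigCellInd`). It vanishes at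
`1`, while `w • e` takes the value `1` there, so `Ind = V_η ⊕ k (w • e)`.

Injectivity: an intertwiner that kills `V_η` kills `e`, hence `w • e`, hence everything.

Surjectivity: a `B`-map `φ` on `V_η` extends to the linear map `Φ` with `Φ (w • e) = w • φ e`
(`exists_linearMap_extension`), and `Φ` has to be shown equivariant (`map_indRep`). This rests on
contraction: `l(y) t(s) = t(s) l(s² y)`, so if `v` is a smooth vector of any representation and `K`
is compact, then `t(s) v` is fixed by `l(y)` for all `y ∈ K` once `s` is small
(`eventually_lowerUni_torus`). It applies to `e` and to `φ e` simultaneously, and thereby forces on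
`φ` the equivariance under lower unipotent matrices that is not part of the hypothesis.

* If `f ∈ V_η` also vanishes at `w`, its support on the big cell is a compact subset `K` of `Fˣ`,
  and for all small `s` it is a finite linear combination of the functions `u(-a) t(s) e` with `a ∈ K`
  (`exists_finset_sum_translates`). Since `w u(-a) = b l((-a)⁻¹)` with `b ∈ B`, contraction gives
  `w u(-a) t(s) e = b t(s) e`, and the same identity with `φ e` for `e`; so `Φ (w f) = w Φ f`
  (`map_weyl_of_vanish`). Subtracting a multiple of `e` extends this to all of `V_η`, and `Φ`
  commutes with `w`.
* `V_η` and `w t(s) e` span `Ind`, and `u(a) w t(s) e = w l(-a) t(s) e = w t(s) e` for small `s`,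
  with the same identity for `φ e`; so `Φ` commutes with every `u(a)`.

As `w` and the `u(a)` generate `SL₂(F)`, this is all that is needed. Of the local field only the
following is used: it is a nondiscrete topological field with a compact open valuation ring.
-/

namespace SmoothRep

open Filter Topology

/-! ### Matrices in `SL₂` -/

section Matrices

variable {F : Type*} [Field F]

/-- The upper unipotent matrix with entry `x`. -/
def upperUni (x : F) : SL(2, F) := ⟨!![1, x; 0, 1], by simp⟩

/-- The lower unipotent matrix with entry `y`. -/
def lowerUni (y : F) : SL(2, F) := ⟨!![1, 0; y, 1], by simp⟩

/-- The representative `!![0, -1; 1, 0]` of the nontrivial Weyl group element. -/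
def weyl : SL(2, F) := ⟨!![0, -1; 1, 0], by simp⟩

/-- The diagonal matrix with entries `s` and `s⁻¹`. -/
def torus (s : Fˣ) : SL(2, F) := ⟨!![(s : F), 0; 0, ((s⁻¹ : Fˣ) : F)], by simp⟩

@[simp] lemma coe_upperUni (x : F) : (upperUni x).1 = !![1, x; 0, 1] := rfl

@[simp] lemma coe_lowerUni (y : F) : (lowerUni y).1 = !![1, 0; y, 1] := rfl

@[simp] lemma coe_weyl : (weyl : SL(2, F)).1 = !![0, -1; 1, 0] := rfl

@[simp] lemma coe_torus (s : Fˣ) : (torus s).1 = !![(s : F), 0; 0, ((s⁻¹ : Fˣ) : F)] := rfl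

lemma mem_borelSL2 {g : SL(2, F)} : g ∈ borelSL2 F ↔ g.1 1 0 = 0 := Iff.rfl

lemma upperUni_mem (x : F) : upperUni x ∈ borelSL2 F := by simp [mem_borelSL2]

lemma torus_mem (s : Fˣ) : torus s ∈ borelSL2 F := by simp [mem_borelSL2]

@[simp] lemma upperUni_zero : upperUni (0 : F) = 1 := by
  ext i j; fin_cases i <;> fin_cases j <;> simp

@[simp] lemma lowerUni_zero : lowerUni (0 : F) = 1 := by
  ext i j; fin_cases i <;> fin_cases j <;> simp

lemma upperUni_add (x y : F) : upperUni (x + y) = upperUni x * upperUni y := by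
  ext i j; fin_cases i <;> fin_cases j <;> simp [add_comm]

lemma lowerUni_mul_torus (y : F) (s : Fˣ) :
    lowerUni y * torus s = torus s * lowerUni ((s : F) * (s * y)) := by
  ext i j; fin_cases i <;> fin_cases j <;> simp [mul_comm]

lemma weyl_mul_upperUni_mul_torus (x : F) (s : Fˣ) :
    weyl * (upperUni x * torus s) =
      torus s⁻¹ * (weyl * upperUni (((s⁻¹ : Fˣ) : F) * (((s⁻¹ : Fˣ) : F) * x))) := by
  ext i j; fin_cases i <;> fin_cases j <;> simp [mul_comm]

lemma weyl_mul_torus (s : Fˣ) : weyl * torus s = torus s⁻¹ * weyl := by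
  ext i j; fin_cases i <;> fin_cases j <;> simp

lemma upperUni_mul_weyl (x : F) : upperUni x * weyl = weyl * lowerUni (-x) := by
  ext i j; fin_cases i <;> fin_cases j <;> simp

lemma weyl_mul_weyl_mem : (weyl * weyl : SL(2, F)) ∈ borelSL2 F := by
  simp [mem_borelSL2]

/-- The relation in `SL₂` that moves `weyl * upperUni x`, for `x ≠ 0`, into the opposite big
cell. -/
lemma weyl_mul_upperUni_eq {x : F} (hx : x ≠ 0) :
    ∃ b ∈ borelSL2 F, weyl * upperUni x = b * lowerUni x⁻¹ := by
  refine ⟨weyl * upperUni x * (lowerUni x⁻¹)⁻¹, ?_, by group⟩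
  simp [mem_borelSL2, Matrix.adjugate_fin_two, hx]

lemma borel_mul_weyl_mul_upperUni {g : SL(2, F)} (h : g.1 1 0 ≠ 0) :
    g * (weyl * upperUni (g.1 1 1 / g.1 1 0))⁻¹ ∈ borelSL2 F := by
  rw [mem_borelSL2]
  simp [Matrix.adjugate_fin_two, Matrix.mul_apply, Fin.sum_univ_two]
  field_simp
  ring

/-- Bruhat decomposition. -/
lemma borel_or_bigCell (g : SL(2, F)) :
    g ∈ borelSL2 F ∨ ∃ b ∈ borelSL2 F, ∃ x, g = b * (weyl * upperUni x) := by
  by_cases h : g.1 1 0 = 0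
  · exact Or.inl h
  · exact Or.inr ⟨_, borel_mul_weyl_mul_upperUni h, g.1 1 1 / g.1 1 0, by group⟩

/-- `SL₂(F)` is generated by the upper unipotent matrices and the Weyl element. -/
lemma mem_of_upperUni_of_weyl (M : Subgroup SL(2, F)) (hu : ∀ x, upperUni x ∈ M)
    (hw : weyl ∈ M) (g : SL(2, F)) : g ∈ M := by
  have hl : ∀ y, lowerUni y ∈ M := fun y => by
    have : lowerUni y = weyl⁻¹ * (upperUni (-y) * weyl) := by
      rw [upperUni_mul_weyl]; simp
    rw [this]
    exact M.mul_mem (M.inv_mem hw) (M.mul_mem (hu _) hw)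
  have key : ∀ g : SL(2, F), g.1 1 0 ≠ 0 → g ∈ M := fun g hg => by
    have hdet := g.2
    rw [Matrix.det_fin_two] at hdet
    have : g = upperUni ((g.1 0 0 - 1) / g.1 1 0) *
        (lowerUni (g.1 1 0) * upperUni ((g.1 1 1 - 1) / g.1 1 0)) := by
      ext i j
      fin_cases i <;> fin_cases j <;>
        simp [hg] <;> field_simp <;> grind
    rw [this]
    exact M.mul_mem (hu _) (M.mul_mem (hl _) (hu _))
  by_cases h : g.1 1 0 = 0
  · have h0 : g.1 0 0 ≠ 0 := fun h0 => by
      have := g.2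
      rw [Matrix.det_fin_two, h, h0] at this
      simp at this
    have : weyl * g ∈ M := key _ (by simpa [Matrix.mul_apply, Fin.sum_univ_two] using h0)
    exact (M.mul_mem_cancel_left hw).1 this
  · exact key g h

end Matrices

/-! ### Topology of unipotent matrices -/

section Topology

variable {F : Type*} [Field F] [TopologicalSpace F]

lemma continuous_entry (i j : Fin 2) : Continuous fun g : SL(2, F) => g.1 i j :=
  continuous_subtype_val.matrix_elem i j

lemma continuous_upperUni : Continuous (upperUni : F → SL(2, F)) := by
  refine continuous_induced_rng.2 (continuous_matrix fun i j => ?_)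
  fin_cases i <;> fin_cases j <;> simp <;> fun_prop

lemma continuous_lowerUni : Continuous (lowerUni : F → SL(2, F)) := by
  refine continuous_induced_rng.2 (continuous_matrix fun i j => ?_)
  fin_cases i <;> fin_cases j <;> simp <;> fun_prop

variable [IsTopologicalDivisionRing F]

/-- The filter of units tending to zero. -/
abbrev unitsToZero (F : Type*) [Field F] [TopologicalSpace F] : Filter Fˣ :=
  comap Units.val (𝓝 (0 : F))

instance unitsToZero_neBot [(𝓝[≠] (0 : F)).NeBot] : (unitsToZero F).NeBot := by
  rw [comap_neBot_iff]
  intro t ht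
  obtain ⟨x, hx, hx0⟩ := (inferInstance : (𝓝[≠] (0 : F)).NeBot).nonempty_of_mem
    (inter_mem_inf ht (mem_principal_self _))
  exact ⟨Units.mk0 x hx0, hx⟩

/-- Scaling by small units contracts compact sets into a given neighbourhood of the identity. -/
lemma eventually_mul_mul_mem {G : Type*} [Group G] [TopologicalSpace G] {e : F → G}
    (he : Continuous e) (he0 : e 0 = 1) {K : Set F} (hK : IsCompact K) {N : Set G}
    (hN : N ∈ 𝓝 1) : ∀ᶠ s : Fˣ in unitsToZero F, ∀ y ∈ K, e ((s : F) * (s * y)) ∈ N := by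
  have : ∀ᶠ s : F in 𝓝 0, ∀ y ∈ K, e (s * (s * y)) ∈ N := by
    refine hK.eventually_forall_of_forall_eventually fun y _ => ?_
    have hc : Continuous fun z : F × F => e (z.1 * (z.1 * z.2)) := by fun_prop
    refine hc.continuousAt.eventually_mem ?_
    simpa [he0] using hN
  exact this.comap _

end Topology

/-! ### Functions supported on the big cell -/

section BigCell

variable {F : Type*} [Field F] {k : Type*} [Field k] (η : borelSL2 F →* kˣ)

open Classical in
/-- The function on `SL₂(F)` supported on the part `B * weyl * upperUni O` of the big cell, with
value `η b` at `b * weyl * upperUni x` for `x ∈ O`. -/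
noncomputable def bigCellFun (O : Set F) (g : SL(2, F)) : k :=
  if h : g.1 1 0 ≠ 0 ∧ g.1 1 1 / g.1 1 0 ∈ O then
    (η ⟨g * (weyl * upperUni (g.1 1 1 / g.1 1 0))⁻¹, borel_mul_weyl_mul_upperUni h.1⟩ : k)
  else 0

variable {η}

lemma bigCellFun_borel_mul (O : Set F) (b : borelSL2 F) (g : SL(2, F)) :
    bigCellFun η O (b.1 * g) = (η b : k) * bigCellFun η O g := by
  have hb : b.1.1 1 0 = 0 := b.2
  have hb1 : b.1.1 1 1 ≠ 0 := fun h => by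
    have := b.1.2
    rw [Matrix.det_fin_two, hb, h] at this
    simp at this
  have h10 : (b.1 * g).1 1 0 = b.1.1 1 1 * g.1 1 0 := by
    simp [Matrix.mul_apply, Fin.sum_univ_two, hb]
  have h11 : (b.1 * g).1 1 1 = b.1.1 1 1 * g.1 1 1 := by
    simp [Matrix.mul_apply, Fin.sum_univ_two, hb]
  have hq : (b.1 * g).1 1 1 / (b.1 * g).1 1 0 = g.1 1 1 / g.1 1 0 := by
    rw [h10, h11, mul_div_mul_left _ _ hb1]
  have h0 : (b.1 * g).1 1 0 ≠ 0 ↔ g.1 1 0 ≠ 0 := by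
    rw [h10]; simp [hb1]
  unfold bigCellFun
  by_cases h : g.1 1 0 ≠ 0 ∧ g.1 1 1 / g.1 1 0 ∈ O
  · rw [dif_pos h, dif_pos (by rwa [h0, hq]), ← Units.val_mul, ← map_mul]
    congr 2
    ext1
    simp only [hq, Subgroup.coe_mul, mul_assoc]
  · rw [dif_neg h, dif_neg (by rwa [h0, hq]), mul_zero]

lemma bigCellFun_weyl_mul_upperUni (O : Set F) (x : F) [Decidable (x ∈ O)] :
    bigCellFun η O (weyl * upperUni x) = if x ∈ O then 1 else 0 := by
  have h10 : (weyl * upperUni x).1 1 0 = 1 := by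
    simp [Matrix.mul_apply, Fin.sum_univ_two]
  have h11 : (weyl * upperUni x).1 1 1 = x := by
    simp [Matrix.mul_apply, Fin.sum_univ_two]
  have hq : (weyl * upperUni x).1 1 1 / (weyl * upperUni x).1 1 0 = x := by
    rw [h10, h11, div_one]
  unfold bigCellFun
  by_cases h : x ∈ O
  · rw [dif_pos (by simpa [hq, h10] using h), if_pos h]
    have : (⟨_, borel_mul_weyl_mul_upperUni (by rw [h10]; exact one_ne_zero)⟩ : borelSL2 F) = 1 :=
      Subtype.ext (mul_inv_eq_one.2 (by rw [hq]))
    rw [this, map_one, Units.val_one]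
  · rw [dif_neg (by simpa [hq, h10] using h), if_neg h]

lemma bigCellFun_one (O : Set F) : bigCellFun η O 1 = 0 := by
  unfold bigCellFun
  rw [dif_neg]
  simp

lemma bigCellFun_mul_of_forall {O : Set F} {g : SL(2, F)}
    (hg : ∀ x ∈ O, bigCellFun η O (weyl * upperUni x * g) = 1) {h : SL(2, F)}
    (hh : bigCellFun η O h ≠ 0) : bigCellFun η O (h * g) = bigCellFun η O h := by
  classical
  have hh' : h.1 1 0 ≠ 0 ∧ h.1 1 1 / h.1 1 0 ∈ O := by
    by_contra hc
    exact hh (dif_neg hc)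
  have e : h * g = h * (weyl * upperUni (h.1 1 1 / h.1 1 0))⁻¹ *
      (weyl * upperUni (h.1 1 1 / h.1 1 0) * g) := by group
  rw [e, bigCellFun_borel_mul O ⟨_, borel_mul_weyl_mul_upperUni hh'.1⟩, hg _ hh'.2, mul_one,
    bigCellFun, dif_pos hh']

end BigCell

/-! ### The smooth induction of a character -/

section Induced

variable {F : Type*} [Field F] [TopologicalSpace F]
  {k : Type*} [Field k] {η : borelSL2 F →* kˣ}

/-- A smooth character is trivial near the identity. -/
lemma exists_nhds_char_eq_one (hη : IsSmooth (charRep η)) :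
    ∃ N ∈ 𝓝 (1 : borelSL2 F), ∀ b ∈ N, η b = 1 := by
  obtain ⟨U, hU⟩ := hη 1
  refine ⟨U, U.isOpen.mem_nhds U.one_mem, fun b hb => Units.ext ?_⟩
  simpa [charRep] using hU b hb

variable [IsTopologicalDivisionRing F] (η)

/-- The smooth induction of the character `η` from the Borel subgroup to `SL₂(F)`, as a vector
space. -/
abbrev IndSpace := (smoothInd (borelSL2 F) (charRep η)).toSubmodule

/-- The action of `SL₂(F)` on the smooth induction of `η` by right translation. -/
abbrev indRep : Representation k SL(2, F) (IndSpace η) :=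
  smoothIndRep (borelSL2 F) (charRep η)

variable {η}

lemma indRep_apply (g : SL(2, F)) (f : IndSpace η) (g' : SL(2, F)) :
    (indRep η g f).1.1 g' = f.1.1 (g' * g) := rfl

lemma ind_borel_mul (f : IndSpace η) (b : borelSL2 F) (g : SL(2, F)) :
    f.1.1 (b.1 * g) = (η b : k) * f.1.1 g := f.1.2 b g

lemma ind_borel (f : IndSpace η) {b : SL(2, F)} (hb : b ∈ borelSL2 F) :
    f.1.1 b = (η ⟨b, hb⟩ : k) * f.1.1 1 := by
  simpa using ind_borel_mul f ⟨b, hb⟩ 1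

lemma isSmooth_indRep : IsSmooth (indRep η) := fun f =>
  let ⟨U, hU⟩ := f.2
  ⟨U, fun g hg => Subtype.ext (hU g hg)⟩

lemma ind_ext {f f' : IndSpace η} (h1 : f.1.1 1 = f'.1.1 1)
    (hw : ∀ x, f.1.1 (weyl * upperUni x) = f'.1.1 (weyl * upperUni x)) : f = f' := by
  refine Subtype.ext (Subtype.ext (funext fun g => ?_))
  rcases borel_or_bigCell g with hg | ⟨b, hb, x, rfl⟩
  · rw [ind_borel f hg, ind_borel f' hg, h1]
  · rw [ind_borel_mul f ⟨b, hb⟩, ind_borel_mul f' ⟨b, hb⟩, hw]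

variable [T1Space F]

/-- For `g` near the identity, `weyl * upperUni x * g` stays in `B * weyl * upperUni O`, uniformly
in `x ∈ O`, and its Borel component is near the identity. -/
lemma eventually_bigCellFun_mul (hη : IsSmooth (charRep η)) {O : Set F} (hc : IsCompact O)
    (ho : IsOpen O) : ∀ᶠ g in 𝓝 (1 : SL(2, F)), ∀ x ∈ O,
      bigCellFun η O (weyl * upperUni x * g) = 1 := by
  obtain ⟨N, hN, hN1⟩ := exists_nhds_char_eq_one hη
  obtain ⟨M, hM, hMN⟩ := mem_nhds_induced _ _ _ |>.1 hN
  refine hc.eventually_forall_of_forall_eventually fun x hx => ?_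
  let m : SL(2, F) × F → SL(2, F) := fun z => weyl * upperUni z.2 * z.1
  have hm : Continuous m := by
    have := continuous_upperUni (F := F)
    fun_prop
  have hm10 : Continuous fun z => (m z).1 1 0 := (continuous_entry 1 0).comp hm
  have hm11 : Continuous fun z => (m z).1 1 1 := (continuous_entry 1 1).comp hm
  have e10 : (m (1, x)).1 1 0 = 1 := by simp [m, Matrix.mul_apply, Fin.sum_univ_two]
  have e11 : (m (1, x)).1 1 1 = x := by simp [m, Matrix.mul_apply, Fin.sum_univ_two]
  have hq : ContinuousAt (fun z => (m z).1 1 1 / (m z).1 1 0) (1, x) :=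
    hm11.continuousAt.div hm10.continuousAt (by rw [e10]; exact one_ne_zero)
  have eq : (m (1, x)).1 1 1 / (m (1, x)).1 1 0 = x := by rw [e10, e11, div_one]
  have hb : ContinuousAt (fun z => m z * (weyl * upperUni ((m z).1 1 1 / (m z).1 1 0))⁻¹)
      (1, x) := by
    have := continuous_upperUni.continuousAt.comp hq
    exact hm.continuousAt.mul (continuousAt_const.mul this).inv
  have h0 := hm10.continuousAt.eventually_ne (y := (0 : F)) (x := (1, x))
    (by rw [e10]; exact one_ne_zero)
  have h1 := hq.eventually_mem (s := O) (by rw [eq]; exact ho.mem_nhds hx)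
  have h2 := hb.eventually_mem (s := M) (by rw [eq]; simpa [m] using hM)
  filter_upwards [h0, h1, h2] with z hz0 hz1 hz2
  change bigCellFun η O (m z) = 1
  rw [bigCellFun, dif_pos ⟨hz0, hz1⟩, hN1, Units.val_one]
  exact hMN hz2

/-- The element `bigCellFun η O` of the smooth induction, for a compact open set `O`. -/
noncomputable def bigCellInd (hη : IsSmooth (charRep η)) {O : Set F} (hc : IsCompact O)
    (ho : IsOpen O) : IndSpace η :=
  ⟨⟨bigCellFun η O, bigCellFun_borel_mul O⟩, by
    let S : Subgroup SL(2, F) :=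
      { carrier := {g | ∀ h, bigCellFun η O (h * g) = bigCellFun η O h}
        one_mem' := fun h => by rw [mul_one]
        mul_mem' := fun {a b} ha hb h => by rw [← mul_assoc, hb, ha]
        inv_mem' := fun {a} ha h => by rw [← ha (h * a⁻¹), inv_mul_cancel_right] }
    have hS : (S : Set SL(2, F)) ∈ 𝓝 1 := by
      have h1 := eventually_bigCellFun_mul hη hc ho
      have h2 : ∀ᶠ g in 𝓝 (1 : SL(2, F)), ∀ x ∈ O,
          bigCellFun η O (weyl * upperUni x * g⁻¹) = 1 :=
        (tendsto_inv (1 : SL(2, F))).eventually (by rwa [inv_one])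
      filter_upwards [h1, h2] with g hg hg' h
      by_cases h0 : bigCellFun η O h = 0
      · by_contra hne
        rw [h0] at hne
        have := bigCellFun_mul_of_forall hg' hne
        rw [mul_inv_cancel_right, h0] at this
        exact hne this.symm
      · exact bigCellFun_mul_of_forall hg h0
    exact ⟨⟨S, S.isOpen_of_mem_nhds hS⟩, fun g hg => Subtype.ext (funext hg)⟩⟩

variable (hη : IsSmooth (charRep η)) {O : Set F} (hc : IsCompact O) (ho : IsOpen O)

lemma bigCellInd_one : (bigCellInd hη hc ho).1.1 1 = 0 := bigCellFun_one O

lemma bigCellInd_weyl_mul_upperUni (x : F) [Decidable (x ∈ O)] :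
    (bigCellInd hη hc ho).1.1 (weyl * upperUni x) = if x ∈ O then 1 else 0 :=
  bigCellFun_weyl_mul_upperUni O x

lemma bigCellInd_weyl (h0 : 0 ∈ O) : (bigCellInd hη hc ho).1.1 weyl = 1 := by
  classical
  simpa [h0] using bigCellInd_weyl_mul_upperUni hη hc ho 0

end Induced

/-! ### Contraction by the torus -/

section Contraction

variable {F : Type*} [Field F] [TopologicalSpace F] [IsTopologicalDivisionRing F]
  {k V : Type*} [Field k] [AddCommMonoid V] [Module k V]

/-- Conjugation by `torus s` contracts the lower unipotent matrices as `s → 0`, so `torus s` moves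
any smooth vector to one that is fixed by a given compact set of lower unipotent matrices. -/
lemma eventually_lowerUni_torus (ρ : Representation k SL(2, F) V) {v : V}
    (hv : IsSmoothVector ρ v) {K : Set F} (hK : IsCompact K) :
    ∀ᶠ s in unitsToZero F, ∀ y ∈ K, ρ (lowerUni y) (ρ (torus s) v) = ρ (torus s) v := by
  obtain ⟨U, hU⟩ := hv
  filter_upwards [eventually_mul_mul_mem continuous_lowerUni lowerUni_zero hK
    (U.isOpen.mem_nhds U.one_mem)] with s hs y hy
  rw [← Module.End.mul_apply, ← map_mul, lowerUni_mul_torus, map_mul, Module.End.mul_apply,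
    hU _ (hs y hy)]

end Contraction

/-! ### Decomposition of functions supported on the big cell -/

section Decomposition

variable {F : Type*} [Field F] [TopologicalSpace F] [IsTopologicalDivisionRing F]
  {k : Type*} [Field k] {η : borelSL2 F →* kˣ} {O : Subring F}

lemma ind_isClosed_support (f : IndSpace η) :
    IsClosed {x : F | f.1.1 (weyl * upperUni x) ≠ 0} := by
  obtain ⟨U, hU⟩ := isSmooth_indRep f
  rw [← isOpen_compl_iff, isOpen_iff_mem_nhds]
  intro x hx
  have hcont : Continuous fun y : F => upperUni (y - x) :=
    continuous_upperUni.comp (continuous_sub_right x)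
  have := hcont.continuousAt.eventually_mem (x := x) (s := (U : Set SL(2, F)))
    (by simpa using U.isOpen.mem_nhds U.one_mem)
  filter_upwards [this] with y hy
  simp only [Set.mem_compl_iff, Set.mem_ofPred_eq, not_not] at hx ⊢
  rw [← hx, ← add_sub_cancel x y, upperUni_add, ← mul_assoc, ← indRep_apply, hU _ hy]

/-- A function in the smooth induction that vanishes at `1` has compact support in the big
cell. -/
lemma ind_isCompact_support [(𝓝[≠] (0 : F)).NeBot] (hc : IsCompact (O : Set F))
    (hO : ∀ x : F, x ∈ O ∨ x⁻¹ ∈ O) {f : IndSpace η} (h1 : f.1.1 1 = 0) :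
    IsCompact {x : F | f.1.1 (weyl * upperUni x) ≠ 0} := by
  obtain ⟨U, hU⟩ := isSmooth_indRep f
  obtain ⟨t, ht⟩ := (eventually_mul_mul_mem continuous_lowerUni lowerUni_zero hc
    (U.isOpen.mem_nhds U.one_mem)).exists
  have hcont : Continuous fun y : F => ((t⁻¹ : Fˣ) : F) * (((t⁻¹ : Fˣ) : F) * y) := by fun_prop
  refine (hc.image hcont).of_isClosed_subset (ind_isClosed_support f) fun x hx => ?_
  refine ⟨t * (t * x), ?_, by simp⟩
  by_contra hn
  have hi := (hO _).resolve_left hn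
  by_cases hx0 : x = 0
  · exact hn (by simp [hx0])
  refine hx ?_
  obtain ⟨b, hb, e⟩ := weyl_mul_upperUni_eq hx0
  have hm := ht _ hi
  have e' : (t : F) * (t * (t * (t * x))⁻¹) = x⁻¹ := by
    have := t.ne_zero
    field_simp
  rw [e'] at hm
  rw [e, ← indRep_apply, hU _ hm, ind_borel f hb, h1, mul_zero]

variable [T1Space F] (hη : IsSmooth (charRep η)) (hc : IsCompact (O : Set F))
  (ho : IsOpen (O : Set F))

lemma torus_bigCellInd_weyl_mul_upperUni (s : Fˣ) (a x : F)
    [Decidable (((s⁻¹ : Fˣ) : F) * (((s⁻¹ : Fˣ) : F) * (x - a)) ∈ O)] :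
    (indRep η (upperUni (-a)) (indRep η (torus s) (bigCellInd hη hc ho))).1.1
      (weyl * upperUni x) =
    if ((s⁻¹ : Fˣ) : F) * (((s⁻¹ : Fˣ) : F) * (x - a)) ∈ O then
      (η ⟨torus s⁻¹, torus_mem _⟩ : k) else 0 := by
  classical
  have e : weyl * upperUni x * upperUni (-a) * torus s = torus s⁻¹ *
      (weyl * upperUni (((s⁻¹ : Fˣ) : F) * (((s⁻¹ : Fˣ) : F) * (x - a)))) := by
    rw [← weyl_mul_upperUni_mul_torus, sub_eq_add_neg, upperUni_add]
    simp only [mul_assoc]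
  rw [indRep_apply, indRep_apply, e, ind_borel_mul _ ⟨torus s⁻¹, torus_mem _⟩,
    bigCellInd_weyl_mul_upperUni]
  split_ifs <;> simp_all

/-- A function in the smooth induction that vanishes at `1` and at `weyl` is, for all small `s`, a
linear combination of translates of `torus s • bigCellInd`, the translations staying in a compact
set `K` of nonzero elements that does not depend on `s`. -/
lemma exists_finset_sum_translates [(𝓝[≠] (0 : F)).NeBot] (hO : ∀ x : F, x ∈ O ∨ x⁻¹ ∈ O)
    {f : IndSpace η} (h1 : f.1.1 1 = 0) (hw : f.1.1 weyl = 0) :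
    ∃ K : Set F, IsCompact K ∧ 0 ∉ K ∧ ∀ᶠ s in unitsToZero F, ∃ A : Finset F, ↑A ⊆ K ∧
      ∃ c : F → k, f = ∑ a ∈ A, c a •
        indRep η (upperUni (-a)) (indRep η (torus s) (bigCellInd hη hc ho)) := by
  classical
  refine ⟨_, ind_isCompact_support hc hO h1, by simpa using hw, ?_⟩
  set K := {x : F | f.1.1 (weyl * upperUni x) ≠ 0} with hKdef
  have hK : IsCompact K := ind_isCompact_support hc hO h1
  obtain ⟨U, hU⟩ := isSmooth_indRep f
  filter_upwards [eventually_mul_mul_mem continuous_upperUni upperUni_zero hc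
    (U.isOpen.mem_nhds U.one_mem)] with s hs
  let H : AddSubgroup F := O.toAddSubgroup.comap
    ((AddMonoidHom.mulLeft ((s⁻¹ : Fˣ) : F)).comp (AddMonoidHom.mulLeft ((s⁻¹ : Fˣ) : F)))
  have hH : ∀ x, x ∈ H ↔ ((s⁻¹ : Fˣ) : F) * (((s⁻¹ : Fˣ) : F) * x) ∈ O := fun x => Iff.rfl
  have hHo : IsOpen (H : Set F) := by
    have : Continuous fun x : F => ((s⁻¹ : Fˣ) : F) * (((s⁻¹ : Fˣ) : F) * x) := by fun_prop
    exact ho.preimage this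
  have hconst : ∀ x y, x - y ∈ H → f.1.1 (weyl * upperUni x) = f.1.1 (weyl * upperUni y) := by
    intro x y hxy
    have := hs _ ((hH _).1 hxy)
    simp only [Units.mul_inv_cancel_left] at this
    rw [← add_sub_cancel y x, upperUni_add, ← mul_assoc, ← indRep_apply, hU _ this]
  have hq : ∀ x y : F, (x : F ⧸ H) = (y : F ⧸ H) ↔ x - y ∈ H := fun x y => by
    rw [eq_comm, QuotientAddGroup.eq, neg_add_eq_sub]
  have := QuotientAddGroup.discreteTopology hHo
  have hfin : ((fun x : F => (x : F ⧸ H)) '' K).Finite :=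
    (hK.image QuotientAddGroup.continuous_mk).finite_of_discrete
  obtain ⟨A, hAK, hA⟩ := Set.exists_subset_bijOn K (fun x : F => (x : F ⧸ H))
  have hAfin : A.Finite := hA.finite_iff_finite.2 hfin
  refine ⟨hAfin.toFinset, by simpa using hAK, fun a =>
    f.1.1 (weyl * upperUni a) * ((η ⟨torus s⁻¹, torus_mem _⟩ : kˣ) : k)⁻¹, ?_⟩
  let ev : SL(2, F) → IndSpace η →ₗ[k] k := fun g =>
    { toFun := fun f => f.1.1 g, map_add' := fun _ _ => rfl, map_smul' := fun _ _ => rfl }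
  have hev : ∀ g f, ev g f = f.1.1 g := fun _ _ => rfl
  refine ind_ext ?_ fun x => ?_
  · rw [h1]
    change 0 = ev 1 _
    rw [map_sum, Finset.sum_eq_zero]
    intro a _
    rw [map_smul, hev, indRep_apply, indRep_apply, one_mul,
      ind_borel _ (mul_mem (upperUni_mem _) (torus_mem _)), bigCellInd_one, mul_zero, smul_zero]
  · change f.1.1 (weyl * upperUni x) = ev (weyl * upperUni x) _
    have hterm : ∀ a, ev (weyl * upperUni x) ((f.1.1 (weyl * upperUni a) *
        ((η ⟨torus s⁻¹, torus_mem _⟩ : kˣ) : k)⁻¹) •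
        indRep η (upperUni (-a)) (indRep η (torus s) (bigCellInd hη hc ho))) =
        if x - a ∈ H then f.1.1 (weyl * upperUni a) else 0 := fun a => by
      rw [map_smul, hev, torus_bigCellInd_weyl_mul_upperUni]
      simp only [hH]
      split_ifs
      · rw [smul_eq_mul, mul_assoc, inv_mul_cancel₀ (Units.ne_zero _), mul_one]
      · rw [smul_zero]
    rw [map_sum, Finset.sum_congr rfl fun a _ => hterm a]
    by_cases hx : x ∈ K
    · obtain ⟨a, ha, hxa⟩ := hA.surjOn ⟨x, hx, rfl⟩
      have hxa' : x - a ∈ H := (hq _ _).1 hxa.symm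
      rw [Finset.sum_eq_single a, if_pos hxa', hconst _ _ hxa']
      · intro a' ha' hne
        refine if_neg fun h => hne (hA.injOn (by simpa using ha') ha ?_)
        exact ((hq _ _).2 h).symm.trans hxa.symm
      · intro h
        exact absurd (by simpa using ha) h
    · rw [Finset.sum_eq_zero]
      · simpa [hKdef] using hx
      · intro a _
        split_ifs with h
        · rw [← hconst _ _ h]
          simpa [hKdef] using hx
        · rfl

end Decomposition

/-! ### Extension of `B`-equivariant maps -/

section Extension

variable {F : Type*} [Field F] [TopologicalSpace F] [IsTopologicalDivisionRing F]
  {k : Type*} [Field k] {η : borelSL2 F →* kˣ}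
  {V : Type*} [AddCommGroup V] [Module k V]

lemma mem_evalKer {f : IndSpace η} :
    f ∈ (evalKer (borelSL2 F) (charRep η)).toSubmodule ↔ f.1.1 1 = 0 := Iff.rfl

lemma exists_eq_add_smul {g : SL(2, F)} {e : IndSpace η} (he : e.1.1 g ≠ 0) (f : IndSpace η) :
    ∃ (f' : IndSpace η) (c : k), f'.1.1 g = 0 ∧ f = f' + c • e := by
  refine ⟨f + (-(f.1.1 g / e.1.1 g)) • e, f.1.1 g / e.1.1 g, ?_, ?_⟩
  · change f.1.1 g + -(f.1.1 g / e.1.1 g) * e.1.1 g = 0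
    field_simp
    ring
  · rw [add_assoc, ← add_smul, neg_add_cancel, zero_smul, add_zero]

/-- A linear map on the functions vanishing at `1` extends to the whole smooth induction, with a
prescribed value at a function `e` with `e 1 = 1`. -/
lemma exists_linearMap_extension
    (ψ : (evalKer (borelSL2 F) (charRep η)).toSubmodule →ₗ[k] V) {e : IndSpace η}
    (he : e.1.1 1 = 1) (v : V) : ∃ Φ : IndSpace η →ₗ[k] V,
      (∀ (f : IndSpace η) (hf : f.1.1 1 = 0), Φ f = ψ ⟨f, hf⟩) ∧ Φ e = v := by
  let ev : IndSpace η →ₗ[k] k := (evalOne (borelSL2 F) (charRep η)).toLinearMap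
  let P : IndSpace η →ₗ[k] (evalKer (borelSL2 F) (charRep η)).toSubmodule :=
    LinearMap.codRestrict _ (LinearMap.id + (-ev).smulRight e) fun f => by
      rw [mem_evalKer]
      change f.1.1 1 + -f.1.1 1 * e.1.1 1 = 0
      rw [he, mul_one, add_neg_cancel]
  have hP : ∀ (f : IndSpace η) (hf : f.1.1 1 = 0), P f = ⟨f, hf⟩ := fun f hf => Subtype.ext (by
    change f + (-f.1.1 1) • e = f
    rw [hf, neg_zero, zero_smul, add_zero])
  have hPe : P e = 0 := Subtype.ext (by
    change e + (-e.1.1 1) • e = 0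
    rw [he]
    nth_rewrite 1 [← one_smul k e]
    rw [← add_smul, add_neg_cancel, zero_smul])
  refine ⟨ψ ∘ₗ P + ev.smulRight v, fun f hf => ?_, ?_⟩
  · have hev : ev f = 0 := hf
    rw [LinearMap.add_apply, LinearMap.comp_apply, hP f hf, LinearMap.smulRight_apply, hev,
      zero_smul, add_zero]
  · have hev : ev e = 1 := he
    rw [LinearMap.add_apply, LinearMap.comp_apply, hPe, map_zero, LinearMap.smulRight_apply, hev,
      one_smul, zero_add]

variable [T1Space F] (hη : IsSmooth (charRep η))
  {O : Subring F} (hc : IsCompact (O : Set F)) (ho : IsOpen (O : Set F))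
  {π : Representation k SL(2, F) V}
  {Φ : IndSpace η →ₗ[k] V}

include hη hc ho in
/-- A linear map that is `B`-equivariant on the functions vanishing at `1` commutes with `weyl` on
those that vanish at `weyl` as well. -/
lemma map_weyl_of_vanish [(𝓝[≠] (0 : F)).NeBot] (hO : ∀ x : F, x ∈ O ∨ x⁻¹ ∈ O)
    (hπ : IsSmooth π)
    (hB : ∀ f : IndSpace η, f.1.1 1 = 0 → ∀ b ∈ borelSL2 F, Φ (indRep η b f) = π b (Φ f))
    {f : IndSpace η} (h1 : f.1.1 1 = 0) (hw : f.1.1 weyl = 0) :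
    Φ (indRep η weyl f) = π weyl (Φ f) := by
  obtain ⟨K, hK, h0, hf⟩ := exists_finset_sum_translates hη hc ho hO h1 hw
  set e := bigCellInd hη hc ho
  have hK' : IsCompact ((fun a : F => (-a)⁻¹) '' K) := by
    refine hK.image_of_continuousOn (ContinuousOn.inv₀ (by fun_prop) fun a ha h => ?_)
    exact h0 (neg_eq_zero.1 h ▸ ha)
  obtain ⟨s, ⟨A, hA, c, rfl⟩, hs, hs'⟩ := (hf.and
    ((eventually_lowerUni_torus (indRep η) (isSmooth_indRep e) hK').and
      (eventually_lowerUni_torus π (hπ (Φ e)) hK'))).exists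
  have he1 : e.1.1 1 = 0 := bigCellInd_one hη hc ho
  have ht1 : (indRep η (torus s) e).1.1 1 = 0 := by
    rw [indRep_apply, one_mul, ind_borel _ (torus_mem s), he1, mul_zero]
  have hΦt : Φ (indRep η (torus s) e) = π (torus s) (Φ e) := hB e he1 _ (torus_mem s)
  simp only [map_sum, map_smul]
  refine Finset.sum_congr rfl fun a ha => ?_
  have haK : a ∈ K := hA ha
  have ha0 : -a ≠ 0 := fun h => h0 (neg_eq_zero.1 h ▸ haK)
  obtain ⟨b, hb, hbe⟩ := weyl_mul_upperUni_eq ha0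
  -- Both sides become `b • torus s • e` because `torus s • e` and its image are fixed by
  -- `lowerUni (-a)⁻¹`.
  rw [hB _ ht1 _ (upperUni_mem _), hΦt, ← Module.End.mul_apply, ← map_mul, hbe, map_mul,
    Module.End.mul_apply, hs _ ⟨a, haK, rfl⟩, hB _ ht1 _ hb, hΦt]
  conv_rhs => rw [← Module.End.mul_apply, ← map_mul, hbe, map_mul, Module.End.mul_apply,
    hs' _ ⟨a, haK, rfl⟩]

/-- A linear map on the smooth induction is `SL₂(F)`-equivariant as soon as it is `B`-equivariant
on the functions vanishing at `1` and commutes with `weyl` on `bigCellInd`. -/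
theorem map_indRep [(𝓝[≠] (0 : F)).NeBot] (hO : ∀ x : F, x ∈ O ∨ x⁻¹ ∈ O)
    (hπ : IsSmooth π)
    (hB : ∀ f : IndSpace η, f.1.1 1 = 0 → ∀ b ∈ borelSL2 F, Φ (indRep η b f) = π b (Φ f))
    (hw : Φ (indRep η weyl (bigCellInd hη hc ho)) = π weyl (Φ (bigCellInd hη hc ho)))
    (g : SL(2, F)) (f : IndSpace η) : Φ (indRep η g f) = π g (Φ f) := by
  set e := bigCellInd hη hc ho
  have he1 : e.1.1 1 = 0 := bigCellInd_one hη hc ho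
  have hew : e.1.1 weyl = 1 := bigCellInd_weyl hη hc ho O.zero_mem
  have hV : ∀ f : IndSpace η, f.1.1 1 = 0 → Φ (indRep η weyl f) = π weyl (Φ f) := fun f hf => by
    obtain ⟨f', c, hf', rfl⟩ := exists_eq_add_smul (by rw [hew]; exact one_ne_zero) f
    have hf1 : f'.1.1 1 = 0 := by
      have : f'.1.1 1 + c * e.1.1 1 = 0 := hf
      rwa [he1, mul_zero, add_zero] at this
    simp only [map_add, map_smul, hw, map_weyl_of_vanish hη hc ho hO hπ hB hf1 hf']
  -- The functions vanishing at `1` have codimension one, so equivariance under `g` need only be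
  -- checked on them and on one more function.
  have hsplit : ∀ (g : SL(2, F)) (e' : IndSpace η), e'.1.1 1 ≠ 0 →
      (∀ f : IndSpace η, f.1.1 1 = 0 → Φ (indRep η g f) = π g (Φ f)) →
      Φ (indRep η g e') = π g (Φ e') → ∀ f, Φ (indRep η g f) = π g (Φ f) := by
    intro g e' he' h0 h1 f
    obtain ⟨f', c, hf', rfl⟩ := exists_eq_add_smul he' f
    simp only [map_add, map_smul, h1, h0 f' hf']
  let M : Subgroup SL(2, F) :=
    { carrier := {g | ∀ f, Φ (indRep η g f) = π g (Φ f)}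
      one_mem' := fun f => by simp only [map_one, Module.End.one_apply]
      mul_mem' := fun {a b} ha hb f => by
        simp only [map_mul, Module.End.mul_apply]; rw [ha, hb]
      inv_mem' := fun {a} ha f => by
        have := ha (indRep η a⁻¹ f)
        rw [Representation.self_inv_apply] at this
        rw [this, Representation.inv_self_apply] }
  refine mem_of_upperUni_of_weyl M (fun a => ?_) ?_ g f
  · obtain ⟨s, hs, hs'⟩ := ((eventually_lowerUni_torus (indRep η) (isSmooth_indRep e)
      (isCompact_singleton (x := -a))).and
        (eventually_lowerUni_torus π (hπ (Φ e)) isCompact_singleton)).exists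
    have hΦt : Φ (indRep η (torus s) e) = π (torus s) (Φ e) := hB e he1 _ (torus_mem s)
    have hΦwt : Φ (indRep η weyl (indRep η (torus s) e)) = π weyl (π (torus s) (Φ e)) := by
      rw [hV _ _, hΦt]
      rw [indRep_apply, one_mul, ind_borel _ (torus_mem s), he1, mul_zero]
    refine hsplit _ (indRep η weyl (indRep η (torus s) e)) ?_
      (fun f hf => hB f hf _ (upperUni_mem a)) ?_
    · rw [indRep_apply, indRep_apply, one_mul, weyl_mul_torus,
        ind_borel_mul _ ⟨torus s⁻¹, torus_mem _⟩, hew, mul_one]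
      exact Units.ne_zero _
    · rw [hΦwt, ← Module.End.mul_apply, ← map_mul, upperUni_mul_weyl, map_mul,
        Module.End.mul_apply, hs _ rfl, hΦwt]
      conv_rhs => rw [← Module.End.mul_apply, ← map_mul, upperUni_mul_weyl, map_mul,
        Module.End.mul_apply, hs' _ rfl]
  · refine hsplit _ (indRep η weyl e) ?_ hV ?_
    · rw [indRep_apply, one_mul, hew]
      exact one_ne_zero
    · rw [hw, ← Module.End.mul_apply, ← Module.End.mul_apply, ← map_mul, ← map_mul,
        hB e he1 _ weyl_mul_weyl_mem]

include hη hc ho in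
lemma restrictToEvalKer_injective (π : Representation k SL(2, F) V) :
    Function.Injective (restrictToEvalKer (borelSL2 F) (charRep η) π) := by
  rw [injective_iff_map_eq_zero]
  intro φ hφ
  have h0 : ∀ f : IndSpace η, f.1.1 1 = 0 → φ f = 0 := fun f hf =>
    DFunLike.congr_fun hφ (⟨f, hf⟩ : (evalKer (borelSL2 F) (charRep η)).toSubmodule)
  have hφg : ∀ g f, φ (indRep η g f) = π g (φ f) := fun g f =>
    Representation.IntertwiningMap.isIntertwining _ _ φ g f
  set e := bigCellInd hη hc ho
  have he1 : e.1.1 1 = 0 := bigCellInd_one hη hc ho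
  have hew : e.1.1 weyl = 1 := bigCellInd_weyl hη hc ho O.zero_mem
  refine DFunLike.ext _ _ fun f => ?_
  obtain ⟨f', c, hf', rfl⟩ := exists_eq_add_smul (e := indRep η weyl e) (g := 1)
    (by rw [indRep_apply, one_mul, hew]; exact one_ne_zero) f
  change φ (f' + c • indRep η weyl e) = 0
  simp only [map_add, map_smul, hφg, h0 e he1, h0 f' hf', map_zero, smul_zero, add_zero]

include hη hc ho in
lemma restrictToEvalKer_surjective [(𝓝[≠] (0 : F)).NeBot] (hO : ∀ x : F, x ∈ O ∨ x⁻¹ ∈ O)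
    (hπ : IsSmooth π) :
    Function.Surjective (restrictToEvalKer (borelSL2 F) (charRep η) π) := by
  intro ψ
  set e := bigCellInd hη hc ho
  have he1 : e.1.1 1 = 0 := bigCellInd_one hη hc ho
  have hew : (indRep η weyl e).1.1 1 = 1 := by
    rw [indRep_apply, one_mul]
    exact bigCellInd_weyl hη hc ho O.zero_mem
  obtain ⟨Φ, hΦ, hΦw⟩ := exists_linearMap_extension ψ.toLinearMap hew (π weyl (ψ ⟨e, he1⟩))
  replace hΦw : Φ (indRep η weyl e) = π weyl (Φ e) := by rw [hΦw, hΦ e he1]; rfl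
  have hB : ∀ f : IndSpace η, f.1.1 1 = 0 → ∀ b ∈ borelSL2 F, Φ (indRep η b f) = π b (Φ f) := by
    intro f hf b hb
    have hbf : (indRep η b f).1.1 1 = 0 := by
      rw [indRep_apply, one_mul, ind_borel f hb, hf, mul_zero]
    rw [hΦ f hf, hΦ _ hbf]
    exact Representation.IntertwiningMap.isIntertwining _ _ ψ ⟨b, hb⟩ ⟨f, hf⟩
  refine ⟨Φ.intertwiningMap_of_isIntertwiningMap _ _ (map_indRep hη hc ho hO hπ hB hΦw), ?_⟩
  refine DFunLike.ext _ _ fun f => ?_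
  exact hΦ f.1 f.2

end Extension

/-! ### Local fields -/

section LocalField

variable (F : Type*) [Field F] [ValuativeRel F] [TopologicalSpace F] [IsNonarchimedeanLocalField F]

lemma t1Space_of_isNonarchimedeanLocalField : T1Space F := by
  refine IsTopologicalAddGroup.t1Space F ?_
  rw [← isOpen_compl_iff, isOpen_iff_mem_nhds]
  intro x hx
  have hx0 : ValuativeRel.valuation F x ≠ 0 := (map_ne_zero _).2 hx
  have h := (IsValuativeTopology.hasBasis_nhds_zero' F).mem_of_mem hx0
  have hs : Tendsto (fun y => x - y) (𝓝 x) (𝓝 0) := by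
    simpa using (continuous_sub_left x).tendsto x
  filter_upwards [hs h] with y hy
  rintro rfl
  simp at hy

lemma nhdsNE_zero_neBot_of_isNonarchimedeanLocalField : (𝓝[≠] (0 : F)).NeBot := by
  rw [nhdsWithin, inf_principal_neBot_iff]
  intro t ht
  obtain ⟨γ, hγ, hγt⟩ := (IsValuativeTopology.hasBasis_nhds_zero' F).mem_iff.1 ht
  obtain ⟨r, hr0, hr⟩ :=
    Valuation.IsNontrivial.exists_lt_one (v := ValuativeRel.valuation F)
  obtain ⟨y, rfl⟩ := ValuativeRel.valuation_surjective γ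
  refine ⟨r * y, hγt ?_, ?_⟩
  · simpa using mul_lt_mul_of_pos_right hr (zero_lt_iff.2 hγ)
  · exact mul_ne_zero (fun h => hr0 (by simp [h])) (fun h => hγ (by simp [h]))

end LocalField

end SmoothRep

theorem theorem5p10 (p : ℕ) [Fact p.Prime]
    (F : Type*) [Field F] [ValuativeRel F] [TopologicalSpace F] [IsNonarchimedeanLocalField F]
    [CharP (IsLocalRing.ResidueField 𝒪[F]) p]
    (k : Type*) [Field k] [IsAlgClosed k] [CharP k p]
    (η : SmoothRep.borelSL2 F →* kˣ) (hη : SmoothRep.IsSmooth (SmoothRep.charRep η))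
    {V : Type*} [AddCommGroup V] [Module k V]
    (π : Representation k SL(2, F) V) (hπ : SmoothRep.IsSmooth π) :
    Function.Bijective
      (SmoothRep.restrictToEvalKer (SmoothRep.borelSL2 F) (SmoothRep.charRep η) π) := by
  have := SmoothRep.t1Space_of_isNonarchimedeanLocalField F
  have := SmoothRep.nhdsNE_zero_neBot_of_isNonarchimedeanLocalField F
  have hc : IsCompact (𝒪[F] : Set F) := IsNonarchimedeanLocalField.isCompact_closedBall F 1
  have ho : IsOpen (𝒪[F] : Set F) := Valuation.isOpen_integer
  have hO : ∀ x : F, x ∈ 𝒪[F] ∨ x⁻¹ ∈ 𝒪[F] := fun x => by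
    simp only [Valuation.mem_integer_iff, map_inv₀]
    rcases le_total (ValuativeRel.valuation F x) 1 with h | h
    · exact Or.inl h
    · exact Or.inr (inv_le_one_of_one_le₀ h)
  exact ⟨SmoothRep.restrictToEvalKer_injective hη hc ho π,
    SmoothRep.restrictToEvalKer_surjective hη hc ho hO hπ⟩
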